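/- Let $k$ be an infinite field, let $A$ and $B$ be finite-dimensional associative unital $k$-algebras, and let $\phi\colon A\to B$ be an algebra extension, that is, a homomorphism of $k$-algebras (not necessarily injective). Through $\phi$, regard $B$ as a right $A$-module $B_A$ and every left $B$-module as a left $A$-module. Write $A\text{-mod}$ and $B\text{-mod}$ for the categories of finitely generated left modules. A finite-dimensional $k$-algebra $\Lambda$ is called derived-discrete over $k$ if for every finitely supported vector $\underline{n}=(n_i)_{i\in\mathbb{Z}}$ of natural numbers there are only finitely many isomorphism classes of objects $X$ in the bounded derived category $\mathbf{D}^b(\Lambda\text{-mod})$ with $\dim_k H^i(X)=n_i$ for all $i\in\mathbb{Z}$. A functor $F\colon\mathcal{C}\to\mathcal{D}$ is called separable if there are maps $H_{X,Y}\colon\mathrm{Hom}_{\mathcal{D}}(F(X),F(Y))\to\mathrm{Hom}_{\mathcal{C}}(X,Y)$, natural in the objects $X$ and $Y$ of $\mathcal{C}$, such that $H_{X,Y}(F(f))=f$ for all $f\in\mathrm{Hom}_{\mathcal{C}}(X,Y)$. The extension $\phi$ is called split if the functor $B\otimes_A-\colon A\text{-mod}\to B\text{-mod}$ is separable, and separable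 if the restriction functor $B\text{-mod}\to A\text{-mod}$ along $\phi$ is separable. Then the following statements hold. (1) If $\phi$ is a split extension and $B$ is derived-discrete over $k$, then $A$ is derived-discrete over $k$. (2) If $\phi$ is a separable extension, the right $A$-module $B_A$ is projective, and $A$ is derived-discrete over $k$, then $B$ is derived-discrete over $k$. -/

import Mathlib

open CategoryTheory
open scoped TensorProduct

universe u

namespace DerivedDiscrete

/-! ### Derived-discrete algebras -/

section DerivedDiscreteness

variable (k : Type u) {A : Type u} [Field k] [Ring A] [Algebra k A]

/-- The `k`-dimension of a finitely generated left module `M` over a `k`-algebra `A`, where `k`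
acts on `M` through `algebraMap k A`. -/
noncomputable def kdim (M : FGModuleCat.{u} A) : ℕ :=
  letI : Module k M := Module.compHom M (algebraMap k A)
  Module.finrank k M

/-- The cohomology dimension vector `i ↦ dim_k Hⁱ(X)` of an object `X` of `D^b(A-mod)`. -/
noncomputable def cohomologyDim [IsNoetherianRing A]
    [HasDerivedCategory.{u + 1} (FGModuleCat.{u} A)]
    (X : DerivedCategory.Bounded (FGModuleCat.{u} A)) (i : ℤ) : ℕ :=
  kdim k ((DerivedCategory.homologyFunctor (FGModuleCat.{u} A) i).obj X.obj)

variable (A) in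
/-- A finite-dimensional `k`-algebra `A` is derived-discrete over `k` if for each finitely
supported vector `n : ℤ → ℕ` there are only finitely many isomorphism classes of objects of
`D^b(A-mod)` whose cohomology dimension vector is `n`. Here `D^b(A-mod)` is formed with
Mathlib's standard construction of the localization at the quasi-isomorphisms. -/
def IsDerivedDiscrete [Module.Finite k A] : Prop :=
  haveI : IsNoetherianRing A := IsNoetherianRing.of_finite k A
  letI : HasDerivedCategory.{u + 1} (FGModuleCat.{u} A) := HasDerivedCategory.standard _
  ∀ n : ℤ →₀ ℕ,
    Set.Finite {c : Quotient (isIsomorphicSetoid (DerivedCategory.Bounded (FGModuleCat.{u} A))) |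
      ∃ X : DerivedCategory.Bounded (FGModuleCat.{u} A),
        Quotient.mk _ X = c ∧ ∀ i : ℤ, cohomologyDim k X i = n i}

end DerivedDiscreteness

/-! ### Separable functors -/

/-- A functor `F` is separable if the maps `Hom(X, Y) → Hom(F X, F Y)` admit retractions `H X Y`
which are natural in `X` and in `Y`. -/
def IsSeparableFunctor {C : Type*} {D : Type*} [Category C] [Category D] (F : C ⥤ D) : Prop :=
  ∃ H : ∀ X Y : C, (F.obj X ⟶ F.obj Y) → (X ⟶ Y),
    (∀ (X Y : C) (f : X ⟶ Y), H X Y (F.map f) = f) ∧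
    (∀ (X' X Y Y' : C) (f : X' ⟶ X) (h : F.obj X ⟶ F.obj Y) (g : Y ⟶ Y'),
      H X' Y' (F.map f ≫ h ≫ F.map g) = f ≫ H X Y h ≫ g)

/-! ### Extension and restriction of scalars along a ring homomorphism -/

section Extension

variable {A B : Type u} [Ring A] [Ring B] (φ : A →+* B)

section Tensor

variable (M : Type u) [AddCommGroup M] [Module A M]

/-- The left `B`-submodule of `B ⊗[ℤ] M` generated by the elements `b φ(a) ⊗ m - b ⊗ a m`. -/
def balancedRelations : Submodule B (B ⊗[ℤ] M) :=
  Submodule.span B {x | ∃ (b : B) (a : A) (m : M), x = (b * φ a) ⊗ₜ[ℤ] m - b ⊗ₜ[ℤ] (a • m)}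

/-- The left `B`-module `B ⊗_A M`, where `B` is a right `A`-module through `φ`. The rings need
not be commutative. -/
abbrev ExtendScalars : Type u := (B ⊗[ℤ] M) ⧸ balancedRelations φ M

variable {M}

/-- The element `b ⊗ m` of `B ⊗_A M`. -/
def extendMk (b : B) (m : M) : ExtendScalars φ M := (balancedRelations φ M).mkQ (b ⊗ₜ[ℤ] m)

theorem extendMk_mul (b : B) (a : A) (m : M) :
    extendMk φ (b * φ a) m = extendMk φ b (a • m) :=
  (Submodule.Quotient.eq _).2 (Submodule.subset_span ⟨b, a, m, rfl⟩)

theorem extend_span : Submodule.span B (Set.range (extendMk φ (1 : B) (M := M))) = ⊤ := by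
  refine eq_top_iff.2 fun x _ => ?_
  obtain ⟨y, rfl⟩ := Submodule.mkQ_surjective _ x
  induction y using TensorProduct.induction_on with
  | zero => simp
  | add y z hy hz => rw [map_add]; exact add_mem (hy trivial) (hz trivial)
  | tmul b m =>
    have h : (balancedRelations φ M).mkQ (b ⊗ₜ[ℤ] m) = b • extendMk φ (1 : B) m := by
      rw [extendMk, ← map_smul, TensorProduct.smul_tmul', smul_eq_mul, mul_one]
    rw [h]
    exact Submodule.smul_mem _ _ (Submodule.subset_span ⟨m, rfl⟩)

theorem extend_finite [Module.Finite A M] : Module.Finite B (ExtendScalars φ M) := by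
  classical
  obtain ⟨s, hs⟩ := Module.Finite.fg_top (R := A) (M := M)
  refine ⟨⟨s.image (extendMk φ (1 : B)), ?_⟩⟩
  rw [eq_top_iff, ← extend_span, Submodule.span_le]
  rintro _ ⟨m, rfl⟩
  have hm : m ∈ Submodule.span A (s : Set M) := hs ▸ Submodule.mem_top
  suffices h : ∀ b : B, extendMk φ b m ∈
      Submodule.span B ((s.image (extendMk φ (1 : B)) : Finset _) : Set (ExtendScalars φ M)) from
    h 1
  induction hm using Submodule.span_induction with
  | mem x hx =>
    intro b
    have h : extendMk φ b x = b • extendMk φ (1 : B) x := by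
      rw [extendMk, extendMk, ← map_smul, TensorProduct.smul_tmul', smul_eq_mul, mul_one]
    rw [h]
    refine Submodule.smul_mem _ _ (Submodule.subset_span ?_)
    exact Finset.mem_coe.2 (Finset.mem_image_of_mem _ (Finset.mem_coe.1 hx))
  | zero => intro b; simp [extendMk]
  | add x y _ _ hx hy =>
    intro b
    have h : extendMk φ b (x + y) = extendMk φ b x + extendMk φ b y := by
      rw [extendMk, TensorProduct.tmul_add, map_add]; rfl
    rw [h]
    exact add_mem (hx b) (hy b)
  | smul a x _ hx =>
    intro b
    rw [← extendMk_mul]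
    exact hx _

variable {N P : Type u} [AddCommGroup N] [Module A N] [AddCommGroup P] [Module A P]

/-- The `B`-linear map `B ⊗_A f : B ⊗_A M → B ⊗_A N`, given by `b ⊗ m ↦ b ⊗ f m`. -/
def extendMap (f : M →ₗ[A] N) : ExtendScalars φ M →ₗ[B] ExtendScalars φ N :=
  Submodule.mapQ (balancedRelations φ M) (balancedRelations φ N)
    (TensorProduct.AlgebraTensorModule.map (LinearMap.id : B →ₗ[B] B) (f.restrictScalars ℤ)) <| by
    rw [balancedRelations, Submodule.span_le]
    rintro _ ⟨b, a, m, rfl⟩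
    refine Submodule.subset_span ⟨b, a, f m, ?_⟩
    simp

@[simp]
theorem extendMap_mk (f : M →ₗ[A] N) (b : B) (m : M) :
    extendMap φ f (extendMk φ b m) = extendMk φ b (f m) := by
  simp [extendMap, extendMk]

theorem extend_hom_ext {Q : Type u} [AddCommGroup Q] [Module B Q]
    {g h : ExtendScalars φ M →ₗ[B] Q}
    (H : ∀ m : M, g (extendMk φ 1 m) = h (extendMk φ 1 m)) : g = h := by
  refine LinearMap.ext_on (extend_span φ) ?_
  rintro _ ⟨m, rfl⟩
  exact H m

end Tensor

/-- The functor `B ⊗_A - : A-mod ⥤ B-mod` between categories of finitely generated left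
modules. -/
noncomputable def extensionFunctor : FGModuleCat.{u} A ⥤ FGModuleCat.{u} B where
  obj M := ⟨ModuleCat.of B (ExtendScalars φ M), extend_finite φ⟩
  map f := ObjectProperty.homMk (ModuleCat.ofHom (extendMap φ f.hom.hom))
  map_id M := by
    ext1
    exact extend_hom_ext φ fun m => by simp
  map_comp f g := by
    ext1
    exact extend_hom_ext φ fun m => by simp

end Extension

section Algebras

variable {k A B : Type u} [Field k] [Ring A] [Ring B] [Algebra k A] [Algebra k B]
  (φ : A →ₐ[k] B)

/-- Restriction along `φ : A → B` preserves finitely generated modules if `B` is a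
finite-dimensional algebra. -/
theorem restrict_finite [Module.Finite k B] (N : FGModuleCat.{u} B) :
    ModuleCat.isFG A ((ModuleCat.restrictScalars φ.toRingHom).obj N.obj) := by
  let mB : Module A B := Module.compHom B φ.toRingHom
  let mN : Module A N := Module.compHom N φ.toRingHom
  have : IsScalarTower k A B := ⟨fun c a b => by
    change φ (c • a) * b = c • (φ a * b)
    rw [map_smul, smul_mul_assoc]⟩
  have : IsScalarTower A B N := ⟨fun a b n => mul_smul (φ a) b (n : N)⟩
  have : Module.Finite A B := Module.Finite.of_restrictScalars_finite k A B
  exact Module.Finite.trans (R := A) B N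

/-- The restriction functor `Hom_B(B, -) : B-mod ⥤ A-mod` between categories of finitely
generated left modules. -/
noncomputable def restrictionFunctor [Module.Finite k B] :
    FGModuleCat.{u} B ⥤ FGModuleCat.{u} A :=
  (ModuleCat.isFG A).lift ((ModuleCat.isFG B).ι ⋙ ModuleCat.restrictScalars φ.toRingHom)
    (restrict_finite φ)

/-- The algebra extension `φ : A → B` is split if `B ⊗_A - : A-mod ⥤ B-mod` is separable. -/
def IsSplitExtension : Prop := IsSeparableFunctor (extensionFunctor φ.toRingHom)

/-- The algebra extension `φ : A → B` is separable if the restriction functor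
`B-mod ⥤ A-mod` is separable. -/
def IsSeparableExtension [Module.Finite k B] : Prop := IsSeparableFunctor (restrictionFunctor φ)

/-- `B` is projective as a right `A`-module, with `b · a = b * φ a`. Right `A`-modules are left
modules over the opposite ring of `A`. -/
def IsRightProjective : Prop :=
  letI : Module Aᵐᵒᵖ B := Module.compHom B (RingHom.op φ.toRingHom)
  Module.Projective Aᵐᵒᵖ B

end Algebras

end DerivedDiscrete

/-!
Derived-discreteness passes from one algebra to another as soon as the objects of one bounded
derived category with prescribed cohomology dimensions are retracts of finitely many objects
obtained from the other. This rests on two general facts.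

An object `Y` of `D^b(A-mod)` has finitely many retracts up to isomorphism
(`finite_setOf_retract_derivedCategory`). Morphisms of the derived category which are bijective
on cohomology are isomorphisms, so it suffices to consider the image `S` of `End Y` in the
finite-dimensional algebra `∏ End_k(Hⁱ Y)`. Two idempotents which become equivalent in the
semisimple ring `S / rad S` have isomorphic images in `D^b(A-mod)`, since unipotent maps on
cohomology are bijective; and a semisimple ring has finitely many left ideals up to isomorphism.
Neither finite-dimensionality of the morphism spaces of `D^b(A-mod)` nor projective resolutions
are needed.

An object with prescribed cohomology dimensions is represented by a complex which lives in a fixed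
interval and has terms of bounded dimension (`exists_small_model`): inside any bounded
representative, a quasi-isomorphic subcomplex is chosen degree by degree, downwards, generated by
representatives of the cohomology and by preimages of the boundaries already chosen.

Let `F = B ⊗_A -` be extension of scalars and `G` restriction, with `F ⊣ G`. If `F` is separable,
the unit of the adjunction has a natural retraction, so every complex `L` of `A`-modules is a
retract of `G F L`, where `F` and `G` act termwise. For a small representative `L`, the terms of
`F L` have bounded dimension, hence so does its cohomology, and `F L` lies in one of finitely many
isomorphism classes of `D^b(B-mod)`. As `G` is exact, `L` is a retract of one of finitely many
objects. Since only the complex `L` and not its class in the derived category is tensored, no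
derived tensor product enters.

If `G` is separable, the counit has a natural section and every complex `K` of `B`-modules is a
retract of `F G K`. Here `F` is exact because `B_A` is projective, and `G` preserves the dimensions
of the cohomology, so `G K` lies in one of finitely many classes.
-/

/-! ### Idempotents in finite-dimensional algebras -/

namespace IsSemisimpleRing

variable (R : Type*) [Ring R] [IsSemisimpleRing R]

/-- Every simple module over a semisimple ring `R` is a summand of `R`, so there are only finitely
many of them up to isomorphism. -/
theorem exists_finite_simples : ∃ (n : ℕ) (S : Fin n → Submodule R R),
    (∀ i, IsSimpleModule R (S i)) ∧
    ∀ (T : Submodule R R) [IsSimpleModule R T], ∃ i, Nonempty (T ≃ₗ[R] S i) := by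
  obtain ⟨n, S, e, hS⟩ := IsSemisimpleModule.exists_linearEquiv_fin_dfinsupp R R
  refine ⟨n, S, hS, fun T _ => ?_⟩
  have : Nontrivial T := IsSimpleModule.nontrivial R T
  obtain ⟨t, ht⟩ := exists_ne (0 : T)
  by_contra! h
  have hzero : (LinearMap.toSpanSingleton R T t) ∘ₗ e.symm.toLinearMap = 0 := by
    refine DFinsupp.lhom_ext' fun i => ?_
    rcases LinearMap.bijective_or_eq_zero
      ((LinearMap.toSpanSingleton R T t ∘ₗ e.symm.toLinearMap) ∘ₗ DFinsupp.lsingle i) with hb | h0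
    · exact ((h i).false (LinearEquiv.ofBijective _ hb).symm).elim
    · rw [h0, LinearMap.zero_comp]
  refine ht ?_
  simpa using LinearMap.congr_fun hzero (e 1)

/-- The left ideals of a semisimple ring fall into finitely many isomorphism classes: each one is
a sum of simple ideals, and the number of summands is at most the length of the ring. -/
theorem exists_finite_invariant : ∃ (ι : Type) (_ : Finite ι) (τ : Submodule R R → ι),
    ∀ M N : Submodule R R, τ M = τ N → Nonempty (M ≃ₗ[R] N) := by
  obtain ⟨n, S, -, hT⟩ := exists_finite_simples R
  have : IsArtinian R R := inferInstance
  have : IsNoetherian R R := inferInstance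
  obtain ⟨L, hL⟩ := ENat.ne_top_iff_exists.1 (Module.length_ne_top (R := R) (M := R))
  have key : ∀ M : Submodule R R, ∃ c : Σ m : Fin (L + 1), Fin m → Fin n,
      Nonempty (M ≃ₗ[R] (Π₀ j : Fin c.1, S (c.2 j))) := by
    intro M
    obtain ⟨m, T, e, hs⟩ := IsSemisimpleModule.exists_linearEquiv_fin_dfinsupp R M
    have hm : m ≤ L := by
      have h1 : Module.length R M = m := by
        rw [(e.trans DFinsupp.linearEquivFunOnFintype).length_eq, Module.length_pi_of_fintype]
        simp [Module.length_eq_one]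
      have h2 := Module.length_le_of_injective M.subtype M.subtype_injective
      rw [h1, ← hL] at h2
      exact_mod_cast h2
    have h : ∀ j, ∃ i, Nonempty (T j ≃ₗ[R] S i) := by
      intro j
      -- `T j` is a submodule of `M`; its image is an isomorphic left ideal of `R`.
      let f := (T j).equivMapOfInjective M.subtype M.subtype_injective
      have : IsSimpleModule R ((T j).map M.subtype) := IsSimpleModule.congr f.symm
      obtain ⟨i, ⟨g⟩⟩ := hT ((T j).map M.subtype)
      exact ⟨i, ⟨f.trans g⟩⟩
    choose σ hσ using h
    exact ⟨⟨⟨m, by omega⟩, σ⟩, ⟨e.trans (DFinsupp.mapRange.linearEquiv fun j => (hσ j).some)⟩⟩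
  choose τ hτ using key
  refine ⟨_, inferInstance, τ, fun M N h => ?_⟩
  obtain ⟨f⟩ := hτ M
  obtain ⟨g⟩ := hτ N
  rw [← h] at g
  exact ⟨f.trans g.symm⟩

/-- Up to the equivalence `e = a * b`, `f = b * a`, a semisimple ring has finitely many
idempotents. -/
theorem exists_finite_invariant_idempotent :
    ∃ (ι : Type) (_ : Finite ι) (τ : R → ι), ∀ e f : R, IsIdempotentElem e →
      IsIdempotentElem f → τ e = τ f → ∃ a b : R, e * a * f * b * e = e ∧ f * b * e * a * f = f := by
  obtain ⟨ι, hι, τ, h⟩ := exists_finite_invariant R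
  refine ⟨ι, hι, fun e => τ (Submodule.span R {e}), fun e f he hf hef => ?_⟩
  obtain ⟨θ⟩ := h _ _ hef
  let e' : Submodule.span R {e} := ⟨e, Submodule.mem_span_singleton_self e⟩
  let f' : Submodule.span R {f} := ⟨f, Submodule.mem_span_singleton_self f⟩
  have hx : ∀ {g x : R}, IsIdempotentElem g → x ∈ Submodule.span R {g} → x * g = x := by
    intro g x hg hx
    obtain ⟨c, rfl⟩ := Submodule.mem_span_singleton.1 hx
    rw [smul_eq_mul, mul_assoc, hg.eq]
  have hee : e • e' = e' := Subtype.ext he.eq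
  have hff : f • f' = f' := Subtype.ext hf.eq
  have h1 : e * (θ e' : R) = θ e' := by
    rw [← smul_eq_mul, ← Submodule.coe_smul, ← map_smul, hee]
  have h2 : f * (θ.symm f' : R) = θ.symm f' := by
    rw [← smul_eq_mul, ← Submodule.coe_smul, ← map_smul, hff]
  have h3 : (θ e' : R) * f = θ e' := hx hf (θ e').2
  have h4 : (θ.symm f' : R) * e = θ.symm f' := hx he (θ.symm f').2
  have h5 : (θ e' : R) * (θ.symm f' : R) = e := by
    have : (θ e' : R) • f' = θ e' := Subtype.ext h3
    rw [← smul_eq_mul, ← Submodule.coe_smul, ← map_smul, this, LinearEquiv.symm_apply_apply]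
  have h6 : (θ.symm f' : R) * (θ e' : R) = f := by
    have : (θ.symm f' : R) • e' = θ.symm f' := Subtype.ext h4
    rw [← smul_eq_mul, ← Submodule.coe_smul, ← map_smul, this, LinearEquiv.apply_symm_apply]
  refine ⟨θ e', θ.symm f', ?_, ?_⟩
  · rw [h1, h3, h5, he.eq]
  · rw [h2, h4, h6, hf.eq]

end IsSemisimpleRing

/-! ### Retracts of an object with finite-dimensional endomorphism action -/

namespace DerivedDiscrete

/-- Let the endomorphisms of `Y` act through a finite-dimensional algebra `R`, in such a way that
`𝟙 X - f` is invertible whenever `X` is a retract of `Y` and the endomorphism `f` of `X`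
becomes nilpotent in `R`. Then `Y` has finitely many retracts up to isomorphism.

Idempotents of `End Y` which are equivalent modulo the radical of the image of `End Y` in `R`
have isomorphic images. -/
theorem finite_setOf_retract {k D R : Type*} [Field k] [Category D] [Preadditive D] [Linear k D]
    [Ring R] [Algebra k R] [Module.Finite k R] (Y : D) (ρ : End Y →ₐ[k] R)
    (hρ : ∀ (X : D) (h : Retract X Y) (f : X ⟶ X),
      IsNilpotent (ρ (End.of (h.r ≫ f ≫ h.i))) → IsIso (𝟙 X - f)) :
    {c : Quotient (isIsomorphicSetoid D) |
      ∃ X : D, Quotient.mk _ X = c ∧ Nonempty (Retract X Y)}.Finite := by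
  let S := ρ.range
  have : Module.Finite k S := inferInstanceAs (Module.Finite k (Subalgebra.toSubmodule S))
  have : IsArtinianRing S := IsArtinianRing.of_finite k S
  have hS : IsSemiprimaryRing S := inferInstance
  obtain ⟨N, hN⟩ := hS.isNilpotent
  let π : S →+* S ⧸ Ring.jacobson S := Ideal.Quotient.mk _
  let σ : End Y →+* S ⧸ Ring.jacobson S := π.comp ρ.rangeRestrict.toRingHom
  have hσ : Function.Surjective σ :=
    Ideal.Quotient.mk_surjective.comp ρ.rangeRestrict_surjective
  have hiso : ∀ (X : D) (h : Retract X Y) (f : X ⟶ X),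
      σ (End.of (h.r ≫ f ≫ h.i)) = σ (End.of (h.r ≫ h.i)) → IsIso f := by
    intro X h f hf
    have hmem : ρ.rangeRestrict (End.of (h.r ≫ (𝟙 X - f) ≫ h.i)) ∈ Ring.jacobson S := by
      rw [← Ideal.Quotient.eq_zero_iff_mem]
      have : End.of (h.r ≫ (𝟙 X - f) ≫ h.i) =
          End.of (h.r ≫ h.i) - End.of (h.r ≫ f ≫ h.i) := by
        simp [End.of]
      change σ _ = 0
      rw [this, map_sub, hf, sub_self]
    have hnil : IsNilpotent (ρ (End.of (h.r ≫ (𝟙 X - f) ≫ h.i))) := by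
      refine ⟨N, ?_⟩
      have := Ideal.pow_mem_pow hmem N
      rw [hN] at this
      simpa using congrArg Subtype.val this
    simpa using hρ X h _ hnil
  obtain ⟨ι, hι, τ, hτ⟩ :=
    IsSemisimpleRing.exists_finite_invariant_idempotent (S ⧸ Ring.jacobson S)
  have key : ∀ (X₁ X₂ : D) (h₁ : Retract X₁ Y) (h₂ : Retract X₂ Y),
      τ (σ (End.of (h₁.r ≫ h₁.i))) = τ (σ (End.of (h₂.r ≫ h₂.i))) → Nonempty (X₁ ≅ X₂) := by
    intro X₁ X₂ h₁ h₂ h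
    have hid : ∀ {X : D} (h : Retract X Y), IsIdempotentElem (σ (End.of (h.r ≫ h.i))) := by
      intro X h
      rw [IsIdempotentElem, ← map_mul]
      congr 1
      simp [End.of, End.mul_def]
    obtain ⟨a, b, hab, hba⟩ := hτ _ _ (hid h₁) (hid h₂) h
    obtain ⟨u, rfl⟩ := hσ a
    obtain ⟨v, rfl⟩ := hσ b
    -- The products in the ring are compositions in the opposite order.
    let α : X₂ ⟶ X₁ := h₂.i ≫ u ≫ h₁.r
    let β : X₁ ⟶ X₂ := h₁.i ≫ v ≫ h₂.r
    have i₁ : IsIso (β ≫ α) := by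
      refine hiso X₁ h₁ _ ?_
      rw [← hab, ← map_mul, ← map_mul, ← map_mul, ← map_mul]
      congr 1
      simp [α, β, End.of, End.mul_def]
    have i₂ : IsIso (α ≫ β) := by
      refine hiso X₂ h₂ _ ?_
      rw [← hba, ← map_mul, ← map_mul, ← map_mul, ← map_mul]
      congr 1
      simp [α, β, End.of, End.mul_def]
    have : IsSplitEpi α := ⟨⟨⟨inv (β ≫ α) ≫ β, by simp⟩⟩⟩
    have : IsSplitMono α := ⟨⟨⟨β ≫ inv (α ≫ β), by
      rw [← Category.assoc]; simp⟩⟩⟩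
    have : IsIso α := isIso_of_epi_of_isSplitMono α
    exact ⟨(asIso α).symm⟩
  choose X hX h using fun c : {c : Quotient (isIsomorphicSetoid D) |
    ∃ X : D, Quotient.mk _ X = c ∧ Nonempty (Retract X Y)} => c.2
  refine Set.finite_coe_iff.1 <| Finite.of_injective
    (fun c => τ (σ (End.of ((h c).some.r ≫ (h c).some.i)))) fun c d hcd => ?_
  rw [Subtype.ext_iff, ← hX c, ← hX d]
  exact Quotient.sound (key _ _ (h c).some (h d).some hcd)

end DerivedDiscrete

/-! ### Retracts in the bounded derived category -/

namespace DerivedDiscrete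

section HomologyLinear

variable (R : Type*) [Ring R] (C : Type*) [Category C] [Abelian C] [Linear R C]

instance homologyFunctor_linear (i : ℤ) :
    (HomologicalComplex.homologyFunctor C (ComplexShape.up ℤ) i).Linear R where
  map_smul f r := by
    change ShortComplex.homologyMap
      (r • (HomologicalComplex.shortComplexFunctor C (ComplexShape.up ℤ) i).map f) = _
    rw [ShortComplex.homologyMap_smul]
    rfl

instance derivedHomologyFunctor_linear [HasDerivedCategory C] (i : ℤ) :
    (DerivedCategory.homologyFunctor C i).Linear R := by
  let _ : Localization.Lifting DerivedCategory.Q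
      (HomologicalComplex.quasiIso C (ComplexShape.up ℤ))
      (HomologicalComplex.homologyFunctor C (ComplexShape.up ℤ) i)
      (DerivedCategory.homologyFunctor C i) := ⟨DerivedCategory.homologyFunctorFactors C i⟩
  rw [← Localization.functor_linear_iff DerivedCategory.Q
    (HomologicalComplex.quasiIso C (ComplexShape.up ℤ)) R
    (HomologicalComplex.homologyFunctor C (ComplexShape.up ℤ) i)
    (DerivedCategory.homologyFunctor C i)]
  infer_instance

end HomologyLinear

open scoped ModuleCat

variable (k : Type u) {A : Type u} [Field k] [Ring A] [Algebra k A]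

theorem module_finite_fgModuleCat [Module.Finite k A] (M : FGModuleCat.{u} A) :
    Module.Finite k M :=
  Module.Finite.trans (R := k) A M

/-- The action of the endomorphisms of `Y` in the derived category on finitely many cohomology
modules of `Y`, viewed as vector spaces over `k`. -/
noncomputable def cohomologyAction [IsNoetherianRing A]
    [HasDerivedCategory.{u + 1} (FGModuleCat.{u} A)] (s : Finset ℤ)
    (Y : DerivedCategory (FGModuleCat.{u} A)) :
    End Y →ₐ[k] ∀ i : s,
      Module.End k ((DerivedCategory.homologyFunctor (FGModuleCat.{u} A) i).obj Y) :=
  AlgHom.ofLinearMap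
    { toFun := fun f i =>
        ((DerivedCategory.homologyFunctor (FGModuleCat.{u} A) i).map f).hom.hom.restrictScalars k
      map_add' := fun f g => by
        funext i
        rw [Functor.map_add]
        rfl
      map_smul' := fun c f => by
        funext i
        rw [Functor.map_smul]
        rfl }
    (by
      funext i
      change LinearMap.restrictScalars k
        ((DerivedCategory.homologyFunctor (FGModuleCat.{u} A) i).map (𝟙 Y)).hom.hom = _
      rw [CategoryTheory.Functor.map_id]
      rfl)
    (fun f g => by
      funext i
      change LinearMap.restrictScalars k
        ((DerivedCategory.homologyFunctor (FGModuleCat.{u} A) i).map (g ≫ f)).hom.hom = _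
      rw [Functor.map_comp]
      rfl)

/-- An object of the derived category with cohomology in finitely many degrees has finitely many
retracts up to isomorphism. -/
theorem finite_setOf_retract_derivedCategory [Module.Finite k A] [IsNoetherianRing A]
    [HasDerivedCategory.{u + 1} (FGModuleCat.{u} A)] (Y : DerivedCategory (FGModuleCat.{u} A))
    (s : Finset ℤ) (hY : ∀ i ∉ s,
      Limits.IsZero ((DerivedCategory.homologyFunctor (FGModuleCat.{u} A) i).obj Y)) :
    {c : Quotient (isIsomorphicSetoid (DerivedCategory (FGModuleCat.{u} A))) |
      ∃ X, Quotient.mk _ X = c ∧ Nonempty (Retract X Y)}.Finite := by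
  have (M : FGModuleCat.{u} A) : Module.Finite k M := module_finite_fgModuleCat k M
  refine finite_setOf_retract (k := k) Y (cohomologyAction k s Y) fun X h f hf => ?_
  rw [DerivedCategory.isIso_iff]
  intro i
  let H := DerivedCategory.homologyFunctor (FGModuleCat.{u} A) i
  by_cases hi : i ∈ s
  · obtain ⟨N, hN⟩ := hf
    let F : End Y := h.r ≫ f ≫ h.i
    have hcomm : ∀ n : ℕ, ((End.of f ^ n : End X).asHom) ≫ h.i = h.i ≫ F ^ n := by
      intro n
      induction n with
      | zero => exact (Category.id_comp _).trans (Category.comp_id _).symm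
      | succ n ih =>
        rw [pow_succ, pow_succ, End.mul_def, End.mul_def, Category.assoc, ih]
        simp [F]
    have hF : H.map (F ^ N) = 0 := by
      have h0 : cohomologyAction k s Y (F ^ N) = 0 := by rw [map_pow]; exact hN
      ext x
      exact LinearMap.congr_fun (congrFun h0 ⟨i, hi⟩) x
    have h1 : IsNilpotent (End.of (H.map f)) := by
      refine ⟨N, ?_⟩
      have h3 : (End.of (H.map f)) ^ N = H.map (End.of f ^ N : End X).asHom :=
        (map_pow (H.mapEnd X) (End.of f) N).symm
      have h4 : (End.of f ^ N : End X).asHom = h.i ≫ (F ^ N : End Y).asHom ≫ h.r := by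
        rw [← Category.assoc, ← hcomm, Category.assoc, h.retract, Category.comp_id]
      rw [h3, h4, Functor.map_comp, Functor.map_comp, hF]
      simp
    have h2 : IsUnit (1 - End.of (H.map f)) := h1.isUnit_one_sub
    have : H.map (𝟙 X - f) = (1 - End.of (H.map f) : End (H.obj X)) := by
      rw [Functor.map_sub, CategoryTheory.Functor.map_id]; rfl
    change IsIso (H.map (𝟙 X - f))
    rw [this]
    exact (isUnit_iff_isIso _).1 h2
  · have hz : Limits.IsZero (H.obj X) :=
      (hY i hi).of_mono (h.map H).i
    exact hz.isIso hz _

end DerivedDiscrete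

/-! ### Exactness of restriction and extension of scalars -/

namespace DerivedDiscrete

section Exactness

variable {A : Type u} [Ring A] [IsNoetherianRing A]

theorem fgModuleCat_exact_iff (S : ShortComplex (FGModuleCat.{u} A)) :
    S.Exact ↔ ∀ x : S.X₂, S.g.hom.hom x = 0 → ∃ y : S.X₁, S.f.hom.hom y = x := by
  rw [← S.exact_map_iff_of_faithful (forget₂ (FGModuleCat.{u} A) (ModuleCat.{u} A)),
    ShortComplex.moduleCat_exact_iff]
  rfl

end Exactness

section Extension

variable {A B : Type u} [Ring A] [Ring B] (φ : A →+* B)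
variable {M : Type u} [AddCommGroup M] [Module A M]

theorem extendMk_add (b : B) (m m' : M) :
    extendMk φ b (m + m') = extendMk φ b m + extendMk φ b m' := by
  simp [extendMk, TensorProduct.tmul_add]

theorem extendMk_add_left (b b' : B) (m : M) :
    extendMk φ (b + b') m = extendMk φ b m + extendMk φ b' m := by
  simp [extendMk, TensorProduct.add_tmul]

theorem smul_extendMk (c b : B) (m : M) : c • extendMk φ b m = extendMk φ (c * b) m := by
  rw [extendMk, extendMk, ← map_smul, TensorProduct.smul_tmul', smul_eq_mul]

theorem extend_induction {p : ExtendScalars φ M → Prop} (x : ExtendScalars φ M)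
    (zero : p 0) (mk : ∀ b m, p (extendMk φ b m)) (add : ∀ x y, p x → p y → p (x + y)) : p x := by
  obtain ⟨y, rfl⟩ := Submodule.mkQ_surjective _ x
  induction y using TensorProduct.induction_on with
  | zero => simpa using zero
  | add y z hy hz => rw [map_add]; exact add _ _ hy hz
  | tmul b m => exact mk b m

section Lift

variable {Q : Type*} [AddCommGroup Q] (f : B →+ M →+ Q)

theorem biadditive_zsmul {B M Q : Type*} [AddCommGroup B] [AddCommGroup M] [AddCommGroup Q]
    (f : B →+ M →+ Q) (r : ℤ) (b : B) (m : M) : f (r • b) m = f b (r • m) := by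
  rw [map_zsmul, map_zsmul, AddMonoidHom.smul_apply]

theorem liftAddHom_balancedRelations (hf : ∀ b a m, f (b * φ a) m = f b (a • m))
    {x : B ⊗[ℤ] M} (hx : x ∈ balancedRelations φ M) :
    TensorProduct.liftAddHom f (biadditive_zsmul f) x = 0 := by
  set g := TensorProduct.liftAddHom f (biadditive_zsmul f) with hg
  -- `g` is only additive, so the induction over the `B`-span is carried out for all multiples.
  suffices h : ∀ c : B, g (c • x) = 0 by simpa using h 1
  induction hx using Submodule.span_induction with
  | mem x hx =>
    obtain ⟨b, a, m, rfl⟩ := hx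
    intro c
    rw [smul_sub, TensorProduct.smul_tmul', TensorProduct.smul_tmul', map_sub, hg,
      TensorProduct.liftAddHom_tmul, TensorProduct.liftAddHom_tmul, smul_eq_mul, smul_eq_mul,
      ← mul_assoc, hf, sub_self]
  | zero => intro c; rw [smul_zero, map_zero]
  | add x y _ _ hx hy => intro c; rw [smul_add, map_add, hx, hy, add_zero]
  | smul b x _ hx => intro c; rw [smul_smul]; exact hx _

/-- The additive map `B ⊗_A M → Q` induced by a biadditive map `B × M → Q` which is
`A`-balanced. -/
noncomputable def extendLiftAdd (hf : ∀ b a m, f (b * φ a) m = f b (a • m)) :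
    ExtendScalars φ M →+ Q :=
  QuotientAddGroup.lift (balancedRelations φ M).toAddSubgroup
    (TensorProduct.liftAddHom f (biadditive_zsmul f))
    fun _ hx => liftAddHom_balancedRelations φ f hf hx

@[simp]
theorem extendLiftAdd_mk (hf : ∀ b a m, f (b * φ a) m = f b (a • m)) (b : B) (m : M) :
    extendLiftAdd φ f hf (extendMk φ b m) = f b m :=
  TensorProduct.liftAddHom_tmul f (biadditive_zsmul f) b m

end Lift

/-- The `B`-linear map `B ⊗_A M → Q`, `b ⊗ m ↦ b • f m`, induced by a map `f : M → Q` which is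
linear along `φ`. -/
noncomputable def extendLift {Q : Type*} [AddCommGroup Q] [Module B Q] (f : M →ₛₗ[φ] Q) :
    ExtendScalars φ M →ₗ[B] Q where
  toFun := extendLiftAdd φ
    { toFun := fun b => (DistribSMul.toAddMonoidHom Q b).comp f.toAddMonoidHom
      map_zero' := by ext; simp
      map_add' := fun b b' => by ext; simp [add_smul] }
    (fun b a m => by simp [mul_smul])
  map_add' := map_add _
  map_smul' c x := by
    induction x using extend_induction φ with
    | zero => simp
    | mk b m => simp [smul_extendMk, mul_smul]
    | add x y hx hy => rw [smul_add, map_add, hx, hy, map_add, smul_add]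

@[simp]
theorem extendLift_mk {Q : Type*} [AddCommGroup Q] [Module B Q] (f : M →ₛₗ[φ] Q) (b : B) (m : M) :
    extendLift φ f (extendMk φ b m) = b • f m := by
  simp [extendLift]

/-- If `B` is projective as a right `A`-module, then `B ⊗_A -` preserves exactness. A dual basis
`b = ∑ bᵢ fᵢ(b)` reduces a statement about `x ∈ B ⊗_A M` to the elements `fᵢ(x)` of `M`. -/
theorem extendMap_exact
    (hB : letI : Module Aᵐᵒᵖ B := Module.compHom B (RingHom.op φ); Module.Projective Aᵐᵒᵖ B)
    {N P : Type u} [AddCommGroup N] [Module A N] [AddCommGroup P] [Module A P]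
    (f : M →ₗ[A] N) (g : N →ₗ[A] P) (hfg : ∀ n, g n = 0 → ∃ m, f m = n)
    (x : ExtendScalars φ N) (hx : extendMap φ g x = 0) : ∃ y, extendMap φ f y = x := by
  let _ : Module Aᵐᵒᵖ B := Module.compHom B (RingHom.op φ)
  have hsmul : ∀ (a : A) (b : B), MulOpposite.op a • b = b * φ a := fun _ _ => rfl
  obtain ⟨s, hs⟩ := hB.out
  -- `β L c : B ⊗_A L → L` is induced by the coordinate function of `B` with index `c`.
  let β (L : Type u) [AddCommGroup L] [Module A L] (c : B) : ExtendScalars φ L →+ L :=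
    extendLiftAdd φ
      { toFun := fun b => DistribSMul.toAddMonoidHom L (s b c).unop
        map_zero' := by ext; simp
        map_add' := fun b b' => by ext; simp [add_smul] }
      (fun b a m => by
        have h := DFunLike.congr_fun (s.map_smul (MulOpposite.op a) b) c
        rw [hsmul] at h
        simp [h, mul_smul])
  have hβ : ∀ (L : Type u) [AddCommGroup L] [Module A L] (c b : B) (m : L),
      β L c (extendMk φ b m) = (s b c).unop • m := fun L _ _ c b m =>
    extendLiftAdd_mk φ _ _ b m
  have hnat : ∀ (c : B) (x : ExtendScalars φ N), β P c (extendMap φ g x) = g (β N c x) := by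
    intro c x
    induction x using extend_induction φ with
    | zero => simp
    | mk b m => rw [extendMap_mk, hβ, hβ, map_smul]
    | add x y hx hy => simp only [map_add, hx, hy]
  have hfin : ∀ x : ExtendScalars φ N, ∃ t : Finset B, ∀ t' : Finset B, t ⊆ t' →
      ∑ c ∈ t', extendMk φ c (β N c x) = x := by
    classical
    intro x
    induction x using extend_induction φ with
    | zero => exact ⟨∅, fun t' _ => by simp [extendMk]⟩
    | mk b m =>
      refine ⟨(s b).support, fun t' ht' => ?_⟩
      have hb : ∑ c ∈ t', c * φ (s b c).unop = b := by
        conv_rhs => rw [← hs b, Finsupp.linearCombination_apply,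
          Finsupp.sum_of_support_subset _ ht' (fun c a => a • id c) (fun i _ => zero_smul _ _)]
        rfl
      let mk : B →+ ExtendScalars φ N :=
        AddMonoidHom.mk' (fun b => extendMk φ b m) fun b b' => extendMk_add_left φ b b' m
      calc ∑ c ∈ t', extendMk φ c (β N c (extendMk φ b m))
          = ∑ c ∈ t', mk (c * φ (s b c).unop) :=
            Finset.sum_congr rfl fun c _ => by rw [hβ, ← extendMk_mul]; rfl
        _ = mk b := by rw [← map_sum, hb]
    | add x y hx hy =>
      obtain ⟨t₁, h₁⟩ := hx
      obtain ⟨t₂, h₂⟩ := hy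
      refine ⟨t₁ ∪ t₂, fun t' ht' => ?_⟩
      simp only [map_add, extendMk_add, Finset.sum_add_distrib]
      rw [h₁ t' (Finset.union_subset_left ht'), h₂ t' (Finset.union_subset_right ht')]
  obtain ⟨t, ht⟩ := hfin x
  have hpre : ∀ c, ∃ m, f m = β N c x := fun c => hfg _ (by rw [← hnat, hx, map_zero])
  choose m hm using hpre
  refine ⟨∑ c ∈ t, extendMk φ c (m c), ?_⟩
  rw [map_sum]
  conv_rhs => rw [← ht t subset_rfl]
  exact Finset.sum_congr rfl fun c _ => by rw [extendMap_mk, hm]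

/-- The map `M → B ⊗_A M`, `m ↦ 1 ⊗ m`, which is linear along `φ`. -/
noncomputable def extendUnit (M : Type u) [AddCommGroup M] [Module A M] :
    M →ₛₗ[φ] ExtendScalars φ M where
  toFun m := extendMk φ 1 m
  map_add' := extendMk_add φ 1
  map_smul' a m := by rw [← extendMk_mul, smul_extendMk, one_mul, mul_one]

instance extensionFunctor_additive : (extensionFunctor φ).Additive where
  map_add {M N f g} := by
    ext1
    exact extend_hom_ext φ fun m =>
      (extendMap_mk φ _ 1 m).trans <| (extendMk_add φ 1 _ _).trans <|
        (congrArg₂ (· + ·) (extendMap_mk φ _ 1 m) (extendMap_mk φ _ 1 m)).symm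

end Extension

section Adjunction

variable {k A B : Type u} [Field k] [Ring A] [Ring B] [Algebra k A] [Algebra k B]
  (φ : A →ₐ[k] B)

theorem extensionFunctor_preservesHomology [IsNoetherianRing A] [IsNoetherianRing B]
    (hφ : IsRightProjective φ) :
    (extensionFunctor φ.toRingHom).PreservesHomology :=
  Functor.preservesHomology_of_map_exact _ fun S hS => by
    rw [fgModuleCat_exact_iff] at hS ⊢
    exact extendMap_exact φ.toRingHom hφ _ _ hS

variable [Module.Finite k B]

instance restrictionFunctor_additive : (restrictionFunctor φ).Additive where

/-- Extension of scalars is left adjoint to restriction, on finitely generated modules. -/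
noncomputable def extensionRestrictionAdjunction :
    extensionFunctor φ.toRingHom ⊣ restrictionFunctor φ :=
  Adjunction.mkOfHomEquiv
    { homEquiv := fun M N =>
        { toFun := fun g => ObjectProperty.homMk (ModuleCat.ofHom
            (Y := (ModuleCat.restrictScalars φ.toRingHom).obj N.obj)
            { toFun := fun m => g.hom.hom (extendMk φ.toRingHom 1 m)
              map_add' := fun m m' =>
                (congrArg g.hom.hom (extendMk_add _ 1 m m')).trans (map_add g.hom.hom _ _)
              map_smul' := fun a m =>
                (congrArg g.hom.hom (map_smulₛₗ (extendUnit φ.toRingHom M) a m)).trans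
                  (map_smul g.hom.hom _ _) })
          invFun := fun f => ObjectProperty.homMk (ModuleCat.ofHom
            (extendLift φ.toRingHom (Q := N)
              { toFun := fun m => f.hom.hom m
                map_add' := fun m m' => map_add f.hom.hom m m'
                map_smul' := fun a m => map_smul f.hom.hom a m }))
          left_inv := fun g => by
            ext1
            refine extend_hom_ext φ.toRingHom fun m => ?_
            exact (extendLift_mk _ _ _ _).trans (one_smul _ _)
          right_inv := fun f => by
            ext m
            exact (extendLift_mk φ.toRingHom (Q := N) _ _ _).trans (one_smul B (show N from f.hom.hom m)) }
      homEquiv_naturality_left_symm := fun f g => by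
        ext1
        refine extend_hom_ext φ.toRingHom fun m => ?_
        exact (extendLift_mk _ _ _ _).trans <| Eq.symm <|
          (congrArg _ (extendMap_mk φ.toRingHom f.hom.hom 1 m)).trans (extendLift_mk _ _ _ _)
      homEquiv_naturality_right := fun f g => rfl }

variable [IsNoetherianRing A] [IsNoetherianRing B]

instance restrictionFunctor_preservesHomology : (restrictionFunctor φ).PreservesHomology :=
  Functor.preservesHomology_of_map_exact _ fun S hS => by
    rw [fgModuleCat_exact_iff] at hS ⊢
    exact hS

end Adjunction

section Separable

variable {C D : Type*} [Category C] [Category D] {F : C ⥤ D} {G : D ⥤ C}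

/-- The unit of an adjunction with separable left adjoint has a natural retraction. -/
theorem exists_retraction_unit (adj : F ⊣ G) (h : IsSeparableFunctor F) :
    ∃ ν : F ⋙ G ⟶ 𝟭 C, adj.unit ≫ ν = 𝟙 _ := by
  obtain ⟨H, h₁, h₂⟩ := h
  refine ⟨⟨fun X => H _ _ (adj.counit.app (F.obj X)), fun X Y f => ?_⟩, ?_⟩
  · have e₁ := h₂ _ _ _ _ ((F ⋙ G).map f) (adj.counit.app (F.obj Y)) (𝟙 Y)
    have e₂ := h₂ _ _ _ _ (𝟙 _) (adj.counit.app (F.obj X)) f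
    simp only [F.map_id, Category.comp_id, Category.id_comp] at e₁ e₂
    exact e₁.symm.trans <| (congrArg _ (adj.counit.naturality (F.map f))).trans e₂
  · ext X
    have e := h₂ _ _ _ _ (adj.unit.app X) (adj.counit.app (F.obj X)) (𝟙 X)
    simp only [F.map_id, Category.comp_id] at e
    refine e.symm.trans <| (congrArg _ (adj.left_triangle_components X)).trans ?_
    rw [← F.map_id]
    exact h₁ _ _ _

/-- The counit of an adjunction with separable right adjoint has a natural section. -/
theorem exists_section_counit (adj : F ⊣ G) (h : IsSeparableFunctor G) :
    ∃ ν : 𝟭 D ⟶ G ⋙ F, ν ≫ adj.counit = 𝟙 _ := by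
  obtain ⟨H, h₁, h₂⟩ := h
  refine ⟨⟨fun X => H _ _ (adj.unit.app (G.obj X)), fun X Y f => ?_⟩, ?_⟩
  · have e₁ := h₂ _ _ _ _ f (adj.unit.app (G.obj Y)) (𝟙 _)
    have e₂ := h₂ _ _ _ _ (𝟙 _) (adj.unit.app (G.obj X)) ((G ⋙ F).map f)
    simp only [G.map_id, Category.comp_id, Category.id_comp] at e₁ e₂
    exact e₁.symm.trans <| (congrArg _ (adj.unit.naturality (G.map f))).trans e₂
  · ext X
    have e := h₂ _ _ _ _ (𝟙 X) (adj.unit.app (G.obj X)) (adj.counit.app X)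
    simp only [G.map_id, Category.id_comp] at e
    refine e.symm.trans <| (congrArg _ (adj.right_triangle_components X)).trans ?_
    rw [← G.map_id]
    exact h₁ _ _ _

end Separable

end DerivedDiscrete

/-! ### Small models of bounded complexes -/

namespace DerivedDiscrete

section LinearAlgebra

variable (k : Type*) {A : Type*} [Field k] [Ring A] [Algebra k A]

/-- Lifts of a basis of the homology `ker g / im f` generate the cycles modulo boundaries. -/
theorem exists_cycles_generating {L M N H : Type*} [AddCommGroup L] [Module A L]
    [AddCommGroup M] [Module A M] [AddCommGroup N] [Module A N]
    [AddCommGroup H] [Module A H] [Module k H] [IsScalarTower k A H] [Module.Finite k H]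
    (f : L →ₗ[A] M) (g : M →ₗ[A] N) (f' : L →ₗ[A] LinearMap.ker g) (hf : ∀ x, (f' x : M) = f x)
    (e : H ≃ₗ[A] (LinearMap.ker g ⧸ LinearMap.range f')) :
    ∃ v : Fin (Module.finrank k H) → M, (∀ j, g (v j) = 0) ∧
      LinearMap.ker g ≤ Submodule.span A (Set.range v) ⊔ LinearMap.range f := by
  let b := Module.finBasis k H
  choose z hz using fun j => Submodule.Quotient.mk_surjective _ (e (b j))
  refine ⟨fun j => z j, fun j => (z j).2, fun x hx => ?_⟩
  have hspan : ∀ y : LinearMap.ker g ⧸ LinearMap.range f',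
      y ∈ (Submodule.span A (Set.range z)).map (LinearMap.range f').mkQ := by
    intro y
    have h : e.symm y ∈ Submodule.span A (Set.range b) :=
      Submodule.span_le_restrictScalars k A _ (b.span_eq ▸ Submodule.mem_top)
    have h' := Submodule.mem_map_of_mem (f := e.toLinearMap) h
    rw [Submodule.map_span, ← Set.range_comp] at h' ⊢
    have : (e.toLinearMap ∘ b : Fin (Module.finrank k H) → _) = (LinearMap.range f').mkQ ∘ z :=
      funext fun j => (hz j).symm
    rw [this] at h'
    simpa using h'
  obtain ⟨s, hs, hsx⟩ := hspan (Submodule.Quotient.mk ⟨x, hx⟩)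
  obtain ⟨y, hy⟩ := (Submodule.Quotient.eq _).1 hsx.symm
  refine Submodule.mem_sup.2 ⟨s, ?_, f y, ⟨y, rfl⟩, ?_⟩
  · have h := Submodule.mem_map_of_mem (f := (LinearMap.ker g).subtype) hs
    rw [Submodule.map_span, ← Set.range_comp] at h
    exact h
  · rw [← hf, hy]
    simp

theorem finrank_subquotient_le {M H : Type*} [AddCommGroup M] [Module A M] [Module k M]
    [IsScalarTower k A M] [Module.Finite k M] [AddCommGroup H] [Module A H] [Module k H]
    [IsScalarTower k A H] {K : Submodule A M} {P : Submodule A K} (e : H ≃ₗ[A] (K ⧸ P)) :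
    Module.finrank k H ≤ Module.finrank k M := by
  have : Module.Finite k K := inferInstanceAs (Module.Finite k (K.restrictScalars k))
  have h₁ : Module.finrank k H ≤ Module.finrank k K :=
    LinearMap.finrank_le_finrank_of_surjective
      (f := ((e.symm.toLinearMap ∘ₗ P.mkQ).restrictScalars k))
      (e.symm.surjective.comp P.mkQ_surjective)
  exact h₁.trans (LinearMap.finrank_le_finrank_of_injective
    (f := K.subtype.restrictScalars k) K.subtype_injective)

variable [Module.Finite k A]

theorem finrank_span_range_le {M ι : Type*} [AddCommGroup M] [Module A M] [Module k M]
    [IsScalarTower k A M] [Fintype ι] (v : ι → M) :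
    Module.finrank k (Submodule.span A (Set.range v)) ≤ Fintype.card ι * Module.finrank k A := by
  have h := LinearMap.finrank_range_le ((Fintype.linearCombination A v).restrictScalars k)
  rw [Module.finrank_pi_fintype, Finset.sum_const, Finset.card_univ, smul_eq_mul] at h
  rw [← Fintype.range_linearCombination A v]
  exact h

/-- One step in the construction of a small subcomplex. Let `d : L → M` and `d' : M → N` be
consecutive differentials, let `W ≤ N`, and let `v` be cycles which generate the homology at `M`.
The submodule `V` generated by the `v j` and by preimages of generators of `W ⊓ range d'` maps onto
`W ⊓ range d'` and meets each homology class at `M`. -/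
theorem exists_small_submodule {L M N : Type*} [AddCommGroup L] [Module A L]
    [AddCommGroup M] [Module A M] [Module k M] [IsScalarTower k A M]
    [AddCommGroup N] [Module A N] [Module k N] [IsScalarTower k A N] [Module.Finite k N]
    (d : L →ₗ[A] M) (d' : M →ₗ[A] N) (W : Submodule A N) {n : ℕ} (v : Fin n → M)
    (hv : ∀ j, d' (v j) = 0)
    (hv' : LinearMap.ker d' ≤ Submodule.span A (Set.range v) ⊔ LinearMap.range d) :
    ∃ V : Submodule A M, V.map d' = W ⊓ LinearMap.range d' ∧
      LinearMap.ker d' ≤ V ⊔ LinearMap.range d ∧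
      Module.finrank k V ≤ (n + Module.finrank k W) * Module.finrank k A := by
  let W' : Submodule A N := W ⊓ LinearMap.range d'
  have hW : Module.finrank k W' ≤ Module.finrank k W :=
    Submodule.finrank_mono (R := k) (s := W'.restrictScalars k) (t := W.restrictScalars k)
      (show W' ≤ W from inf_le_left)
  have : Module.Finite k W' := inferInstanceAs (Module.Finite k (W'.restrictScalars k))
  let b := Module.finBasis k W'
  have hb : ∀ j, ∃ m, d' m = b j := fun j => (b j).2.2
  choose y hy using hb
  refine ⟨Submodule.span A (Set.range (Sum.elim v y)), ?_, ?_, ?_⟩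
  · rw [Submodule.map_span, ← Set.range_comp]
    apply le_antisymm
    · rw [Submodule.span_le]
      rintro _ ⟨j | j, rfl⟩
      · simp [hv]
      · simp [hy]
    · intro w hw
      have h : (W'.subtype.restrictScalars k) ⟨w, hw⟩ ∈
          Submodule.map (W'.subtype.restrictScalars k) (Submodule.span k (Set.range b)) :=
        Submodule.mem_map_of_mem (b.span_eq ▸ Submodule.mem_top)
      rw [Submodule.map_span, ← Set.range_comp] at h
      refine Submodule.span_le_restrictScalars k A _ (Submodule.span_mono ?_ h)
      rintro _ ⟨j, rfl⟩
      exact ⟨Sum.inr j, hy j⟩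
  · refine hv'.trans (sup_le_sup_right (Submodule.span_mono ?_) _)
    rintro _ ⟨j, rfl⟩
    exact ⟨Sum.inl j, rfl⟩
  · refine (finrank_span_range_le k _).trans (Nat.mul_le_mul_right _ ?_)
    simpa using hW

end LinearAlgebra

section Homology

open scoped ModuleCat

variable (k : Type u) {A : Type u} [Field k] [Ring A] [Algebra k A]

theorem kdim_eq_finrank (M : FGModuleCat.{u} A) : kdim k M = Module.finrank k M := rfl

theorem kdim_congr {M N : FGModuleCat.{u} A} (e : M ≅ N) : kdim k M = kdim k N :=
  ((FGModuleCat.isoToLinearEquiv e).restrictScalars k).finrank_eq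

theorem subsingleton_of_isZero {M : FGModuleCat.{u} A} (h : Limits.IsZero M) : Subsingleton M :=
  subsingleton_of_forall_eq 0 fun x =>
    congrArg (fun f : M ⟶ M => f.hom.hom x) ((Limits.IsZero.iff_id_eq_zero M).1 h)

variable [Module.Finite k A]

theorem isZero_iff_kdim_eq_zero (M : FGModuleCat.{u} A) :
    Limits.IsZero M ↔ kdim k M = 0 := by
  have := module_finite_fgModuleCat k M
  rw [kdim_eq_finrank, Module.finrank_zero_iff]
  refine ⟨subsingleton_of_isZero, fun h => (Limits.IsZero.iff_id_eq_zero M).2 ?_⟩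
  ext x
  exact Subsingleton.elim _ _

variable [IsNoetherianRing A]

theorem exists_homology_generators (S : ShortComplex (FGModuleCat.{u} A)) :
    ∃ v : Fin (kdim k S.homology) → S.X₂, (∀ j, S.g.hom.hom (v j) = 0) ∧
      LinearMap.ker S.g.hom.hom ≤
        Submodule.span A (Set.range v) ⊔ LinearMap.range S.f.hom.hom := by
  have := module_finite_fgModuleCat k S.homology
  let S' := S.map (forget₂ (FGModuleCat.{u} A) (ModuleCat.{u} A))
  exact exists_cycles_generating k S.f.hom.hom S.g.hom.hom S'.moduleCatToCycles (fun _ => rfl)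
    ((S.mapHomologyIso (forget₂ (FGModuleCat.{u} A) (ModuleCat.{u} A))).symm ≪≫
      S'.moduleCatHomologyIso).toLinearEquiv

theorem kdim_homology_le (S : ShortComplex (FGModuleCat.{u} A)) :
    kdim k S.homology ≤ kdim k S.X₂ := by
  have := module_finite_fgModuleCat k S.X₂
  let S' := S.map (forget₂ (FGModuleCat.{u} A) (ModuleCat.{u} A))
  exact finrank_subquotient_le k (M := S.X₂.obj) (H := S.homology.obj)
    (K := LinearMap.ker S.g.hom.hom) (P := LinearMap.range S'.moduleCatToCycles)
    ((S.mapHomologyIso (forget₂ (FGModuleCat.{u} A) (ModuleCat.{u} A))).symm ≪≫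
      S'.moduleCatHomologyIso).toLinearEquiv

end Homology

section Subcomplex

variable {A : Type u} [Ring A] [IsNoetherianRing A] (K : CochainComplex (FGModuleCat.{u} A) ℤ)
  (U : ∀ i, Submodule A (K.X i)) (hU : ∀ i j, U i ≤ (U j).comap (K.d i j).hom.hom)

/-- The subcomplex of `K` given by submodules which are stable under the differential. -/
noncomputable def subcomplex : CochainComplex (FGModuleCat.{u} A) ℤ where
  X i := FGModuleCat.of A (U i)
  d i j := FGModuleCat.ofHom ((K.d i j).hom.hom.restrict (hU i j))
  shape i j h := by
    ext x
    exact congrArg (fun f : K.X i ⟶ K.X j => f.hom.hom x) (K.shape i j h)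
  d_comp_d' i j l _ _ := by
    ext x
    exact congrArg (fun f : K.X i ⟶ K.X l => f.hom.hom x) (K.d_comp_d i j l)

/-- The quotient of `K` by a subcomplex. -/
noncomputable def quotientComplex : CochainComplex (FGModuleCat.{u} A) ℤ where
  X i := FGModuleCat.of A (K.X i ⧸ U i)
  d i j := FGModuleCat.ofHom ((U i).mapQ (U j) (K.d i j).hom.hom (hU i j))
  shape i j h := by
    ext x
    exact congrArg (fun f : K.X i ⟶ K.X j => (U j).mkQ (f.hom.hom x)) (K.shape i j h)
  d_comp_d' i j l _ _ := by
    ext x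
    exact congrArg (fun f : K.X i ⟶ K.X l => (U l).mkQ (f.hom.hom x)) (K.d_comp_d i j l)

/-- The short complex formed by a subcomplex, the complex and the quotient. -/
noncomputable def subcomplexSequence : ShortComplex (CochainComplex (FGModuleCat.{u} A) ℤ) where
  X₁ := subcomplex K U hU
  X₂ := K
  X₃ := quotientComplex K U hU
  f := { f := fun i => FGModuleCat.ofHom (U i).subtype }
  g := { f := fun i => FGModuleCat.ofHom (U i).mkQ }
  zero := by
    ext i x
    exact (Submodule.Quotient.mk_eq_zero (U i)).2 x.2

theorem subcomplexSequence_shortExact : (subcomplexSequence K U hU).ShortExact := by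
  refine HomologicalComplex.shortExact_of_degreewise_shortExact _ fun i => ?_
  refine { exact := ?_, mono_f := ?_, epi_g := ?_ }
  · rw [fgModuleCat_exact_iff]
    intro x hx
    exact ⟨⟨x, (Submodule.Quotient.mk_eq_zero (U i)).1 hx⟩, rfl⟩
  · refine (forget₂ (FGModuleCat.{u} A) (ModuleCat.{u} A)).mono_of_mono_map ?_
    exact (ModuleCat.mono_iff_injective _).2 (U i).subtype_injective
  · refine (forget₂ (FGModuleCat.{u} A) (ModuleCat.{u} A)).epi_of_epi_map ?_
    exact (ModuleCat.epi_iff_surjective _).2 (U i).mkQ_surjective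

theorem quasiIso_of_acyclic {S : ShortComplex (CochainComplex (FGModuleCat.{u} A) ℤ)}
    (hS : S.ShortExact) (h : S.X₃.Acyclic) : QuasiIso S.f := by
  rw [quasiIso_iff]
  intro j
  rw [quasiIsoAt_iff_isIso_homologyMap]
  have hz : ∀ i, Limits.IsZero (S.X₃.homology i) := fun i => (h i).isZero_homology
  have : Mono (HomologicalComplex.homologyMap S.f j) :=
    (hS.homology_exact₁ (j - 1) j (by simp)).mono_g ((hz _).eq_of_src _ _)
  have : Epi (HomologicalComplex.homologyMap S.f j) :=
    (hS.homology_exact₂ j).epi_f ((hz _).eq_of_tgt _ _)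
  exact isIso_of_mono_of_epi _

/-- A subcomplex which meets every cohomology class, and in which every boundary of `K` is the
boundary of an element of the subcomplex, has the cohomology of `K`. -/
theorem subcomplex_quasiIso
    (h₁ : ∀ i, (U i).map (K.d i (i + 1)).hom.hom =
      U (i + 1) ⊓ LinearMap.range (K.d i (i + 1)).hom.hom)
    (h₂ : ∀ i, LinearMap.ker (K.d i (i + 1)).hom.hom ≤
      U i ⊔ LinearMap.range (K.d (i - 1) i).hom.hom) :
    QuasiIso (subcomplexSequence K U hU).f := by
  refine quasiIso_of_acyclic (subcomplexSequence_shortExact K U hU) fun i => ?_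
  change (quotientComplex K U hU).ExactAt i
  rw [HomologicalComplex.exactAt_iff' _ (i - 1) i (i + 1) (by simp) (by simp),
    fgModuleCat_exact_iff]
  intro x hx
  obtain ⟨x, rfl⟩ := Submodule.mkQ_surjective (U i) x
  have hx' : (K.d i (i + 1)).hom.hom x ∈ U (i + 1) := (Submodule.Quotient.mk_eq_zero _).1 hx
  obtain ⟨v, hv, hvx⟩ : (K.d i (i + 1)).hom.hom x ∈ (U i).map (K.d i (i + 1)).hom.hom := by
    rw [h₁]
    exact ⟨hx', x, rfl⟩
  have hker : x - v ∈ LinearMap.ker (K.d i (i + 1)).hom.hom := by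
    rw [LinearMap.mem_ker, map_sub, hvx, sub_self]
  obtain ⟨w, hw, _, ⟨y, rfl⟩, hy⟩ := Submodule.mem_sup.1 (h₂ i hker)
  refine ⟨(U (i - 1)).mkQ y, ?_⟩
  refine (Submodule.Quotient.eq (U i)).2 ?_
  have : (K.d (i - 1) i).hom.hom y - x = -(w + v) := by
    rw [← eq_sub_iff_add_eq.1 hy]
    abel
  exact this ▸ neg_mem (add_mem hw hv)

end Subcomplex

section SmallModel

open scoped ModuleCat

variable (k : Type u) {A : Type u} [Field k] [Ring A] [Algebra k A] [Module.Finite k A]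
  [IsNoetherianRing A]

theorem exists_homology_generators_degree (K : CochainComplex (FGModuleCat.{u} A) ℤ) (i : ℤ) :
    ∃ v : Fin (kdim k (K.homology i)) → K.X i, (∀ j, (K.d i (i + 1)).hom.hom (v j) = 0) ∧
      LinearMap.ker (K.d i (i + 1)).hom.hom ≤
        Submodule.span A (Set.range v) ⊔ LinearMap.range (K.d (i - 1) i).hom.hom := by
  have h := exists_homology_generators k (K.sc' (i - 1) i (i + 1))
  rw [← kdim_congr k (ShortComplex.homologyMapIso
    (K.isoSc' (i - 1) i (i + 1) (by simp) (by simp)))] at h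
  exact h

/-- The bound on the dimension in degree `b + 1 - m` of the small subcomplex of a complex
concentrated in degrees `≤ b`, where `N` bounds the dimensions of the cohomology and `D` is the
dimension of the algebra. -/
def smallModelBound (N D : ℕ) : ℕ → ℕ
  | 0 => 0
  | m + 1 => (N + smallModelBound N D m) * D + smallModelBound N D m

theorem smallModelBound_le_succ (N D m : ℕ) :
    smallModelBound N D m ≤ smallModelBound N D (m + 1) :=
  Nat.le_add_left _ _

theorem exists_small_submodules (K : CochainComplex (FGModuleCat.{u} A) ℤ) (b : ℤ)
    [K.IsStrictlyLE b] (N : ℕ) (hN : ∀ i, kdim k (K.homology i) ≤ N) (m : ℕ) :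
    ∃ U : ∀ i, Submodule A (K.X i), ∀ i, b - m < i →
      ((U i).map (K.d i (i + 1)).hom.hom =
        U (i + 1) ⊓ LinearMap.range (K.d i (i + 1)).hom.hom ∧
      LinearMap.ker (K.d i (i + 1)).hom.hom ≤
        U i ⊔ LinearMap.range (K.d (i - 1) i).hom.hom ∧
      Module.finrank k (U i) ≤ smallModelBound N (Module.finrank k A) m) := by
  induction m with
  | zero =>
    refine ⟨fun _ => ⊥, fun i hi => ?_⟩
    have : Subsingleton (K.X i) :=
      subsingleton_of_isZero (K.isZero_of_isStrictlyLE b i (by simpa using hi))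
    refine ⟨?_, ?_, ?_⟩
    · rw [Submodule.map_bot, bot_inf_eq]
    · exact fun x _ => (Subsingleton.elim 0 x) ▸ zero_mem _
    · exact (Module.finrank_zero_of_subsingleton (R := k)).le
  | succ m ih =>
    classical
    obtain ⟨U, hU⟩ := ih
    obtain ⟨c, hc⟩ : ∃ c : ℤ, c = b - m := ⟨_, rfl⟩
    obtain ⟨v, hv, hv'⟩ := exists_homology_generators_degree k K c
    have : Module.Finite k (K.X (c + 1)) := module_finite_fgModuleCat k _
    obtain ⟨V, hV₁, hV₂, hV₃⟩ := exists_small_submodule k (K.d (c - 1) c).hom.hom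
      (K.d c (c + 1)).hom.hom (U (c + 1)) v hv hv'
    refine ⟨Function.update U c V, fun i hi => ?_⟩
    rcases eq_or_ne i c with rfl | hic
    · rw [Function.update_self, Function.update_of_ne (by simp)]
      refine ⟨hV₁, hV₂, hV₃.trans (le_trans (Nat.mul_le_mul_right _ ?_) (Nat.le_add_right _ _))⟩
      exact Nat.add_le_add (hN i) (hU (i + 1) (by omega)).2.2
    · have hi' : b - m < i := by push_cast at hi; omega
      rw [Function.update_of_ne hic, Function.update_of_ne (by omega)]
      exact ⟨(hU i hi').1, (hU i hi').2.1, (hU i hi').2.2.trans (smallModelBound_le_succ _ _ _)⟩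

/-- A complex concentrated in degrees `[a, b]` has a quasi-isomorphic subcomplex whose dimension is
bounded in terms of the dimensions of the cohomology. -/
theorem exists_small_model (K : CochainComplex (FGModuleCat.{u} A) ℤ) (a b : ℤ)
    [K.IsStrictlyGE a] [K.IsStrictlyLE b] (N : ℕ) (hN : ∀ i, kdim k (K.homology i) ≤ N) :
    ∃ (L : CochainComplex (FGModuleCat.{u} A) ℤ) (f : L ⟶ K), QuasiIso f ∧
      (∀ i, kdim k (L.X i) ≤ smallModelBound N (Module.finrank k A) (b - a + 1).toNat) ∧
      ∀ i, i < a ∨ b < i → kdim k (L.X i) = 0 := by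
  obtain ⟨U, hU⟩ := exists_small_submodules k K b N hN (b - a + 1).toNat
  have hzero : ∀ i, i < a ∨ b < i → Subsingleton (K.X i) := by
    rintro i (h | h)
    · exact subsingleton_of_isZero (K.isZero_of_isStrictlyGE a i h)
    · exact subsingleton_of_isZero (K.isZero_of_isStrictlyLE b i h)
  have hU' : ∀ i, (U i).map (K.d i (i + 1)).hom.hom =
        U (i + 1) ⊓ LinearMap.range (K.d i (i + 1)).hom.hom ∧
      LinearMap.ker (K.d i (i + 1)).hom.hom ≤
        U i ⊔ LinearMap.range (K.d (i - 1) i).hom.hom ∧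
      Module.finrank k (U i) ≤
        smallModelBound N (Module.finrank k A) (b - a + 1).toNat := by
    intro i
    by_cases hi : i < a
    · have := hzero i (Or.inl hi)
      refine ⟨?_, ?_, ?_⟩
      · have h0 : (K.d i (i + 1)).hom.hom = 0 := Subsingleton.elim _ _
        rw [h0, LinearMap.range_zero, inf_bot_eq, Submodule.map_zero]
      · exact fun x _ => (Subsingleton.elim 0 x) ▸ zero_mem _
      · rw [Module.finrank_zero_of_subsingleton]
        exact Nat.zero_le _
    · exact hU i (by have := Int.self_le_toNat (b - a + 1); omega)
  have hle : ∀ i j, U i ≤ (U j).comap (K.d i j).hom.hom := by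
    intro i j x hx
    by_cases hij : i + 1 = j
    · subst hij
      have h : (K.d i (i + 1)).hom.hom x ∈ (U i).map (K.d i (i + 1)).hom.hom :=
        Submodule.mem_map_of_mem hx
      rw [(hU' i).1] at h
      exact h.1
    · have h0 : (K.d i j).hom.hom x = 0 :=
        congrArg (fun f : K.X i ⟶ K.X j => f.hom.hom x) (K.shape i j hij)
      rw [Submodule.mem_comap, h0]
      exact zero_mem _
  refine ⟨subcomplex K U hle, (subcomplexSequence K U hle).f,
    subcomplex_quasiIso K U hle (fun i => (hU' i).1) (fun i => (hU' i).2.1),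
    fun i => (hU' i).2.2, fun i hi => ?_⟩
  have := hzero i hi
  exact Module.finrank_zero_of_subsingleton (R := k) (M := U i)

end SmallModel

end DerivedDiscrete

/-! ### Cohomology dimensions under restriction and extension of scalars -/

namespace DerivedDiscrete

section Dimensions

open scoped ModuleCat

variable {k A B : Type u} [Field k] [Ring A] [Ring B] [Algebra k A] [Algebra k B]
  (φ : A →ₐ[k] B) [Module.Finite k B]

theorem kdim_restrictionFunctor (N : FGModuleCat.{u} B) :
    kdim k ((restrictionFunctor φ).obj N) = kdim k N := by
  let e : (restrictionFunctor φ).obj N ≃ₗ[k] N :=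
    { AddEquiv.refl N with
      map_smul' := fun c x => by
        change φ (algebraMap k A c) • (show N from x) = algebraMap k B c • (show N from x)
        rw [φ.commutes] }
  exact e.finrank_eq

theorem kdim_extensionFunctor_le [Module.Finite k A] (M : FGModuleCat.{u} A) :
    kdim k ((extensionFunctor φ.toRingHom).obj M) ≤ kdim k M * Module.finrank k B := by
  have := module_finite_fgModuleCat k M
  let b := Module.finBasis k M
  let N := (extensionFunctor φ.toRingHom).obj M
  let v : Fin (Module.finrank k M) → N := fun j => extendMk φ.toRingHom (1 : B) (b j)
  have hv : Submodule.span B (Set.range v) = ⊤ := by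
    refine eq_top_iff.2 ((extend_span φ.toRingHom (M := M)).ge.trans (Submodule.span_le.2 ?_))
    rintro _ ⟨m, rfl⟩
    have hm : m ∈ Submodule.span A (Set.range b) :=
      Submodule.span_le_restrictScalars k A _ (b.span_eq ▸ Submodule.mem_top)
    have hle : Submodule.span A (Set.range b) ≤
        (Submodule.span B (Set.range v)).comap (extendUnit φ.toRingHom M) := by
      rw [Submodule.span_le]
      rintro _ ⟨j, rfl⟩
      exact Submodule.subset_span ⟨j, rfl⟩
    exact hle hm
  have h := finrank_span_range_le k (A := B) (M := N.obj) v
  rw [hv, Fintype.card_fin] at h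
  exact (Submodule.topEquiv.restrictScalars k).finrank_eq.ge.trans h

end Dimensions

section Homology

variable {A B : Type u} [Ring A] [Ring B] [IsNoetherianRing A] [IsNoetherianRing B]
  [HasDerivedCategory.{u + 1} (FGModuleCat.{u} A)] [HasDerivedCategory.{u + 1} (FGModuleCat.{u} B)]
  (F : FGModuleCat.{u} A ⥤ FGModuleCat.{u} B) [F.Additive]

/-- The cohomology of `Q.obj K` is the homology of the complex `K`. -/
noncomputable def homologyQIso (K : CochainComplex (FGModuleCat.{u} A) ℤ) (i : ℤ) :
    (DerivedCategory.homologyFunctor (FGModuleCat.{u} A) i).obj (DerivedCategory.Q.obj K) ≅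
      K.homology i :=
  (DerivedCategory.homologyFunctorFactors (FGModuleCat.{u} A) i).app K

variable [Limits.PreservesFiniteLimits F] [Limits.PreservesFiniteColimits F]

/-- Exact functors commute with cohomology on the derived category. -/
theorem homology_mapDerivedCategory (X : DerivedCategory (FGModuleCat.{u} A)) (i : ℤ) :
    Nonempty ((DerivedCategory.homologyFunctor (FGModuleCat.{u} B) i).obj
        (F.mapDerivedCategory.obj X) ≅
      F.obj ((DerivedCategory.homologyFunctor (FGModuleCat.{u} A) i).obj X)) := by
  let K := DerivedCategory.Q.objPreimage X
  let e : DerivedCategory.Q.obj K ≅ X := DerivedCategory.Q.objObjPreimageIso X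
  exact ⟨(DerivedCategory.homologyFunctor _ i).mapIso
      (F.mapDerivedCategory.mapIso e.symm ≪≫ F.mapDerivedCategoryFactors.app K) ≪≫
    homologyQIso _ i ≪≫ (K.sc i).mapHomologyIso F ≪≫
    F.mapIso ((homologyQIso K i).symm ≪≫ (DerivedCategory.homologyFunctor _ i).mapIso e)⟩

end Homology

end DerivedDiscrete

/-! ### Transfer of derived-discreteness -/

namespace DerivedDiscrete

section Finiteness

variable (k : Type u) {A : Type u} [Field k] [Ring A] [Algebra k A]
  [IsNoetherianRing A] [HasDerivedCategory.{u + 1} (FGModuleCat.{u} A)]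

theorem exists_isZero_homology_of_bounded (Y : DerivedCategory.Bounded (FGModuleCat.{u} A)) :
    ∃ s : Finset ℤ, ∀ i ∉ s,
      Limits.IsZero ((DerivedCategory.homologyFunctor (FGModuleCat.{u} A) i).obj Y.obj) := by
  obtain ⟨⟨a, ha⟩, ⟨b, hb⟩⟩ := Y.property
  refine ⟨Finset.Icc a b, fun i hi => ?_⟩
  by_cases h : i < a
  · exact (DerivedCategory.isGE_iff _ a).1 ha i h
  · refine (DerivedCategory.isLE_iff _ b).1 hb i ?_
    rw [Finset.mem_Icc] at hi
    omega

/-- A class of bounded objects is finite up to isomorphism if all its members are retracts of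
finitely many objects of the derived category with cohomology in finitely many degrees. -/
theorem finite_setOf_of_retract [Module.Finite k A] {ι : Type*} {t : Set ι} (ht : t.Finite)
    (R : ι → DerivedCategory (FGModuleCat.{u} A))
    (hR : ∀ j, ∃ s : Finset ℤ, ∀ i ∉ s,
      Limits.IsZero ((DerivedCategory.homologyFunctor (FGModuleCat.{u} A) i).obj (R j)))
    (P : DerivedCategory.Bounded (FGModuleCat.{u} A) → Prop)
    (hP : ∀ X, P X → ∃ j ∈ t, Nonempty (Retract X.obj (R j))) :
    {c : Quotient (isIsomorphicSetoid (DerivedCategory.Bounded (FGModuleCat.{u} A))) |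
      ∃ X, Quotient.mk _ X = c ∧ P X}.Finite := by
  let q : Quotient (isIsomorphicSetoid (DerivedCategory.Bounded (FGModuleCat.{u} A))) →
      Quotient (isIsomorphicSetoid (DerivedCategory (FGModuleCat.{u} A))) :=
    Quotient.map (fun X => X.obj) fun _ _ ⟨e⟩ =>
      ⟨(DerivedCategory.Bounded.ι (C := FGModuleCat.{u} A)).mapIso e⟩
  have hq : Function.Injective q := by
    intro c d h
    induction c using Quotient.inductionOn
    induction d using Quotient.inductionOn
    obtain ⟨e⟩ := Quotient.exact h
    exact Quotient.sound ⟨ObjectProperty.isoMk _ e⟩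
  have hfin : (⋃ j ∈ t, {c : Quotient (isIsomorphicSetoid (DerivedCategory (FGModuleCat.{u} A))) |
      ∃ X, Quotient.mk _ X = c ∧ Nonempty (Retract X (R j))}).Finite := by
    refine ht.biUnion fun j _ => ?_
    obtain ⟨s, hs⟩ := hR j
    exact finite_setOf_retract_derivedCategory k (R j) s hs
  refine (hfin.preimage hq.injOn).subset ?_
  rintro _ ⟨X, rfl, hX⟩
  obtain ⟨j, hj, hr⟩ := hP X hX
  exact Set.mem_biUnion hj ⟨X.obj, rfl, hr⟩

variable (A) in
/-- Derived-discreteness with respect to a given model of the derived category. -/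
def HasDiscreteCohomology : Prop :=
  ∀ n : ℤ →₀ ℕ,
    {c : Quotient (isIsomorphicSetoid (DerivedCategory.Bounded (FGModuleCat.{u} A))) |
      ∃ X, Quotient.mk _ X = c ∧ ∀ i : ℤ, cohomologyDim k X i = n i}.Finite

variable [Module.Finite k A]

theorem cohomologyDim_eq_zero_iff (X : DerivedCategory.Bounded (FGModuleCat.{u} A)) (i : ℤ) :
    cohomologyDim k X i = 0 ↔
      Limits.IsZero ((DerivedCategory.homologyFunctor (FGModuleCat.{u} A) i).obj X.obj) :=
  (isZero_iff_kdim_eq_zero k _).symm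

/-- An object with prescribed cohomology dimensions is represented by a complex whose terms have
bounded dimensions and vanish outside a fixed interval. -/
theorem exists_small_representative (n : ℤ →₀ ℕ) : ∃ (s : Finset ℤ) (N : ℕ),
    ∀ X : DerivedCategory.Bounded (FGModuleCat.{u} A), (∀ i, cohomologyDim k X i = n i) →
      ∃ L : CochainComplex (FGModuleCat.{u} A) ℤ, Nonempty (X.obj ≅ DerivedCategory.Q.obj L) ∧
        (∀ i, kdim k (L.X i) ≤ N) ∧ ∀ i ∉ s, kdim k (L.X i) = 0 := by
  obtain ⟨a, ha⟩ := n.support.bddBelow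
  obtain ⟨b, hb⟩ := n.support.bddAbove
  have hout : ∀ i, i < a ∨ b < i → n i = 0 := by
    intro i hi
    by_contra h
    have h' := Finsupp.mem_support_iff.2 h
    have h₁ := ha h'
    have h₂ := hb h'
    omega
  obtain ⟨N, hN⟩ : ∃ N, ∀ i, n i ≤ N := by
    refine ⟨n.support.sup n, fun i => ?_⟩
    by_cases h : i ∈ n.support
    · exact Finset.le_sup h
    · rw [Finsupp.notMem_support_iff.1 h]
      exact Nat.zero_le _
  refine ⟨Finset.Icc a b, smallModelBound N (Module.finrank k A) (b - a + 1).toNat,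
    fun X hX => ?_⟩
  have : X.obj.IsGE a := (DerivedCategory.isGE_iff _ a).2 fun i hi =>
    (cohomologyDim_eq_zero_iff k X i).1 ((hX i).trans (hout i (Or.inl hi)))
  have : X.obj.IsLE b := (DerivedCategory.isLE_iff _ b).2 fun i hi =>
    (cohomologyDim_eq_zero_iff k X i).1 ((hX i).trans (hout i (Or.inr hi)))
  obtain ⟨K, _, _, ⟨e⟩⟩ := X.obj.exists_iso_Q_obj_of_isGE_of_isLE a b
  have hK : ∀ i, kdim k (K.homology i) ≤ N := fun i => by
    rw [← kdim_congr k (homologyQIso K i), ← kdim_congr k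
      ((DerivedCategory.homologyFunctor (FGModuleCat.{u} A) i).mapIso e)]
    exact (hX i).le.trans (hN i)
  obtain ⟨L, f, hf, hL, hL'⟩ := exists_small_model k K a b N hK
  refine ⟨L, ⟨e ≪≫ (asIso (DerivedCategory.Q.map f)).symm⟩, hL, fun i hi => hL' i ?_⟩
  rw [Finset.mem_Icc] at hi
  omega

end Finiteness

section Complexes

variable {C D : Type*} [Category C] [Category D] [Preadditive C] [Preadditive D]
  (F : C ⥤ D) (G : D ⥤ C) [F.Additive] [G.Additive]

/-- A natural transformation `𝟭 C ⟶ F ⋙ G` with a retraction makes each complex `K` a retract of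
the complex obtained by applying `F` and `G` termwise. -/
noncomputable def complexRetract (η : 𝟭 C ⟶ F ⋙ G) (ν : F ⋙ G ⟶ 𝟭 C) (h : η ≫ ν = 𝟙 _)
    (K : CochainComplex C ℤ) :
    Retract K ((G.mapHomologicalComplex (ComplexShape.up ℤ)).obj
      ((F.mapHomologicalComplex (ComplexShape.up ℤ)).obj K)) where
  i := { f := fun i => η.app (K.X i), comm' := fun i j _ => (η.naturality (K.d i j)).symm }
  r := { f := fun i => ν.app (K.X i), comm' := fun i j _ => (ν.naturality (K.d i j)).symm }
  retract := by
    ext i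
    exact congrArg (fun τ => τ.app (K.X i)) h

end Complexes

section Transfer

variable {k A B : Type u} [Field k] [Ring A] [Algebra k A] [Ring B] [Algebra k B] [Module.Finite k B]
  [IsNoetherianRing A] [IsNoetherianRing B]
  [HasDerivedCategory.{u + 1} (FGModuleCat.{u} A)] [HasDerivedCategory.{u + 1} (FGModuleCat.{u} B)]

theorem exists_isZero_homology_mapDerivedCategory (F : FGModuleCat.{u} A ⥤ FGModuleCat.{u} B)
    [F.Additive] [Limits.PreservesFiniteLimits F] [Limits.PreservesFiniteColimits F]
    (Y : DerivedCategory.Bounded (FGModuleCat.{u} A)) :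
    ∃ s : Finset ℤ, ∀ i ∉ s, Limits.IsZero
      ((DerivedCategory.homologyFunctor (FGModuleCat.{u} B) i).obj
        (F.mapDerivedCategory.obj Y.obj)) := by
  obtain ⟨s, hs⟩ := exists_isZero_homology_of_bounded Y
  exact ⟨s, fun i hi =>
    (F.map_isZero (hs i hi)).of_iso (homology_mapDerivedCategory F Y.obj i).some⟩

theorem bounded_of_isZero (X : DerivedCategory (FGModuleCat.{u} A)) (s : Finset ℤ)
    (h : ∀ i ∉ s, Limits.IsZero ((DerivedCategory.homologyFunctor (FGModuleCat.{u} A) i).obj X)) :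
    DerivedCategory.TStructure.t.bounded X := by
  obtain ⟨a, ha⟩ := s.bddBelow
  obtain ⟨b, hb⟩ := s.bddAbove
  exact ⟨⟨a, (DerivedCategory.isGE_iff _ a).2 fun i hi => h i fun hs => (ha hs).not_gt hi⟩,
    ⟨b, (DerivedCategory.isLE_iff _ b).2 fun i hi => h i fun hs => (hb hs).not_gt hi⟩⟩

variable (φ : A →ₐ[k] B)

/-- If `φ` is split, a bounded complex of `A`-modules is a retract of the restriction of its
termwise extension, so the objects with given cohomology dimensions are retracts of restrictions
of the finitely many objects of `D^b(B)` with suitably bounded cohomology. -/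
theorem hasDiscreteCohomology_of_isSplitExtension [Module.Finite k A] (hφ : IsSplitExtension φ)
    (hB : HasDiscreteCohomology k B) : HasDiscreteCohomology k A := by
  intro n
  obtain ⟨ν, hν⟩ := exists_retraction_unit (extensionRestrictionAdjunction φ) hφ
  obtain ⟨s, N, hsN⟩ := exists_small_representative k (A := A) n
  have : Limits.PreservesFiniteLimits (restrictionFunctor φ) :=
    Functor.preservesFiniteLimits_of_preservesHomology _
  have : Limits.PreservesFiniteColimits (restrictionFunctor φ) :=
    Functor.preservesFiniteColimits_of_preservesHomology _
  let F := extensionFunctor φ.toRingHom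
  let G := restrictionFunctor φ
  -- `F` need not be exact, but it multiplies the dimensions of the terms by at most `dim B`.
  let M : ℤ →₀ ℕ := Finsupp.indicator s fun _ _ => N * Module.finrank k B
  refine finite_setOf_of_retract k ((Set.finite_Iic M).biUnion fun m _ => hB m)
    (fun c => G.mapDerivedCategory.obj c.out.obj)
    (fun c => exists_isZero_homology_mapDerivedCategory G c.out) _ fun X hX => ?_
  obtain ⟨L, ⟨e⟩, hL, hL'⟩ := hsN X hX
  let FL := (F.mapHomologicalComplex (ComplexShape.up ℤ)).obj L
  let Z := DerivedCategory.Q.obj FL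
  have hdim : ∀ i, kdim k ((DerivedCategory.homologyFunctor (FGModuleCat.{u} B) i).obj Z) ≤
      kdim k (L.X i) * Module.finrank k B := fun i =>
    ((kdim_congr k (homologyQIso FL i)).le.trans (kdim_homology_le k (FL.sc i))).trans
      (kdim_extensionFunctor_le φ (L.X i))
  have hdim' : ∀ i ∉ s,
      kdim k ((DerivedCategory.homologyFunctor (FGModuleCat.{u} B) i).obj Z) = 0 := fun i hi => by
    have := hdim i
    rwa [hL' i hi, zero_mul, Nat.le_zero] at this
  let Y : DerivedCategory.Bounded (FGModuleCat.{u} B) :=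
    ⟨Z, bounded_of_isZero Z s fun i hi => (isZero_iff_kdim_eq_zero k _).2 (hdim' i hi)⟩
  let m : ℤ →₀ ℕ := Finsupp.onFinset s (fun i => cohomologyDim k Y i) fun i hi =>
    by_contra fun h => hi (hdim' i h)
  have hm : m ≤ M := by
    intro i
    by_cases hi : i ∈ s
    · rw [Finsupp.indicator_of_mem hi]
      exact (hdim i).trans (Nat.mul_le_mul_right _ (hL i))
    · exact (hdim' i hi).le.trans (Nat.zero_le _)
  refine ⟨Quotient.mk _ Y, Set.mem_biUnion hm ⟨Y, rfl, fun i => rfl⟩, ?_⟩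
  obtain ⟨e'⟩ : (isIsomorphicSetoid _).r (Quotient.mk _ Y).out Y :=
    Quotient.mk_out (s := isIsomorphicSetoid _) Y
  let r := complexRetract F G (extensionRestrictionAdjunction φ).unit ν hν L
  exact ⟨(Retract.ofIso e).trans <| (r.map DerivedCategory.Q).trans <| Retract.ofIso <|
    (G.mapDerivedCategoryFactors.app FL).symm ≪≫
      G.mapDerivedCategory.mapIso
        ((DerivedCategory.Bounded.ι (C := FGModuleCat.{u} B)).mapIso e'.symm)⟩

/-- If `φ` is separable and `B` is projective as a right `A`-module, each object of `D^b(B)` is a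
retract of the extension of its restriction, and restriction preserves cohomology dimensions. -/
theorem hasDiscreteCohomology_of_isSeparableExtension (hφ : IsSeparableExtension φ)
    (hp : IsRightProjective φ) (hA : HasDiscreteCohomology k A) : HasDiscreteCohomology k B := by
  intro n
  obtain ⟨σ, hσ⟩ := exists_section_counit (extensionRestrictionAdjunction φ) hφ
  have := extensionFunctor_preservesHomology φ hp
  have : Limits.PreservesFiniteLimits (restrictionFunctor φ) :=
    Functor.preservesFiniteLimits_of_preservesHomology _
  have : Limits.PreservesFiniteColimits (restrictionFunctor φ) :=
    Functor.preservesFiniteColimits_of_preservesHomology _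
  have : Limits.PreservesFiniteLimits (extensionFunctor φ.toRingHom) :=
    Functor.preservesFiniteLimits_of_preservesHomology _
  have : Limits.PreservesFiniteColimits (extensionFunctor φ.toRingHom) :=
    Functor.preservesFiniteColimits_of_preservesHomology _
  let F := extensionFunctor φ.toRingHom
  let G := restrictionFunctor φ
  refine finite_setOf_of_retract k (hA n) (fun c => F.mapDerivedCategory.obj c.out.obj)
    (fun c => exists_isZero_homology_mapDerivedCategory F c.out) _ fun X hX => ?_
  obtain ⟨s, hs⟩ := exists_isZero_homology_mapDerivedCategory G X
  let Y : DerivedCategory.Bounded (FGModuleCat.{u} A) :=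
    ⟨G.mapDerivedCategory.obj X.obj, bounded_of_isZero _ s hs⟩
  have hY : ∀ i, cohomologyDim k Y i = n i := fun i =>
    ((kdim_congr k (homology_mapDerivedCategory G X.obj i).some).trans
      (kdim_restrictionFunctor φ _)).trans (hX i)
  refine ⟨Quotient.mk _ Y, ⟨Y, rfl, hY⟩, ?_⟩
  obtain ⟨e'⟩ : (isIsomorphicSetoid _).r (Quotient.mk _ Y).out Y :=
    Quotient.mk_out (s := isIsomorphicSetoid _) Y
  let K := DerivedCategory.Q.objPreimage X.obj
  let e : DerivedCategory.Q.obj K ≅ X.obj := DerivedCategory.Q.objObjPreimageIso X.obj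
  let GK := (G.mapHomologicalComplex (ComplexShape.up ℤ)).obj K
  let r := complexRetract G F σ (extensionRestrictionAdjunction φ).counit hσ K
  exact ⟨(Retract.ofIso e.symm).trans <| (r.map DerivedCategory.Q).trans <| Retract.ofIso <|
    (F.mapDerivedCategoryFactors.app GK).symm ≪≫ F.mapDerivedCategory.mapIso
      ((G.mapDerivedCategoryFactors.app K).symm ≪≫ G.mapDerivedCategory.mapIso e ≪≫
        (DerivedCategory.Bounded.ι (C := FGModuleCat.{u} A)).mapIso e'.symm)⟩

end Transfer

end DerivedDiscrete

theorem theorem4p1 {k A B : Type u} [Field k] [Infinite k]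
    [Ring A] [Algebra k A] [Module.Finite k A]
    [Ring B] [Algebra k B] [Module.Finite k B] (φ : A →ₐ[k] B) :
    (DerivedDiscrete.IsSplitExtension φ → DerivedDiscrete.IsDerivedDiscrete k B →
      DerivedDiscrete.IsDerivedDiscrete k A) ∧
    (DerivedDiscrete.IsSeparableExtension φ → DerivedDiscrete.IsRightProjective φ →
      DerivedDiscrete.IsDerivedDiscrete k A → DerivedDiscrete.IsDerivedDiscrete k B) := by
  have : IsNoetherianRing A := IsNoetherianRing.of_finite k A
  have : IsNoetherianRing B := IsNoetherianRing.of_finite k B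
  let _ : HasDerivedCategory.{u + 1} (FGModuleCat.{u} A) := HasDerivedCategory.standard _
  let _ : HasDerivedCategory.{u + 1} (FGModuleCat.{u} B) := HasDerivedCategory.standard _
  exact ⟨DerivedDiscrete.hasDiscreteCohomology_of_isSplitExtension φ,
    DerivedDiscrete.hasDiscreteCohomology_of_isSeparableExtension φ⟩
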